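/- Let $\Sigma$ be a finite alphabet. A language over $\Sigma$ is star-free if it belongs to the smallest class of languages over $\Sigma$ that contains the finite languages and is closed under union, intersection, complement (with respect to $\Sigma^*$) and concatenation. The quotient complexity of a language $L \subseteq \Sigma^*$ is the number of its distinct left quotients $\{y \in \Sigma^* \mid xy \in L\}$, $x \in \Sigma^*$. Theorem. Let $m \ge 2$. If $K$ and $L$ are star-free languages over a common finite alphabet, with quotient complexities $m$ and $2$ respectively, then the product (concatenation) $KL$ has quotient complexity at most $3m-2$; if moreover $\varepsilon \notin L$ (that is, the initial state of the minimal DFA of $L$ is not final), then $KL$ has quotient complexity at most $2m+1$. The bound $3m-2$ is tight: for every $m \ge 2$ there are a finite alphabet and star-free languages $K$ and $L$ over it, with quotient complexities $m$ and $2$ respectively, such that $KL$ has quotient complexity exactly $3m-2$. -/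

import Mathlib

namespace Language

/-- The star-free languages over an alphabet: the smallest class of languages that contains the
finite languages and is closed under the boolean operations and concatenation. -/
inductive IsStarFree {α : Type*} : Language α → Prop
  | of_finite {L : Language α} (hL : {w : List α | w ∈ L}.Finite) : IsStarFree L
  | sup {K L : Language α} (hK : IsStarFree K) (hL : IsStarFree L) : IsStarFree (K ⊔ L)
  | inf {K L : Language α} (hK : IsStarFree K) (hL : IsStarFree L) : IsStarFree (K ⊓ L)
  | compl {L : Language α} (hL : IsStarFree L) : IsStarFree Lᶜ
  | mul {K L : Language α} (hK : IsStarFree K) (hL : IsStarFree L) : IsStarFree (K * L)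

/-- The quotient complexity of a language: the number of its distinct left quotients
(equivalently, for a regular language, the number of states of its minimal complete DFA).
It is `⊤` if there are infinitely many left quotients. -/
noncomputable def quotientComplexity {α : Type*} (L : Language α) : ℕ∞ :=
  (Set.range L.leftQuotient).encard

end Language

/-! Star-freeness is used only through aperiodicity: no word can swap two distinct quotients
(`IsAperiodic.not_swap`). If `L` has just the two quotients `L` and `L'`, exactly one contains the
empty word, and a word in the other but not in this one would swap them. Hence the two quotients are
nested (`IsAperiodic.quotient_le`).

Every quotient of `K * L` is a quotient of `K` times `L`, plus a union of quotients of `L`;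
nestedness reduces that union to `0`, `L` or `L'`. If `[] ∈ L`, then `L` is the larger one and the
union is absorbed as soon as the quotient of `K` contains `[]`, which leaves at most `3 * (m - 1) +
1` values. If `[] ∉ L`, then `L` is a left ideal and even `m + 2` bounds the count.

For tightness, `K` tests whether a counter with resets has reached `m - 1`, and `L` tests a bit of
the last letter. Resets bring the counter back down after a run of `L` has begun, so every counter
value below `m - 1` occurs with no run, a rejecting run and an accepting run. -/

namespace Language

variable {α : Type*}

/-! ### Star-free languages are aperiodic -/

/-- A language is aperiodic if, from some exponent on, replacing a power of a factor by the next
power does not affect membership. -/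
def IsAperiodic (L : Language α) : Prop :=
  ∃ n : ℕ, ∀ N, n ≤ N → ∀ u v w : List α,
    u ++ ((List.replicate N v).flatten ++ w) ∈ L ↔
      u ++ ((List.replicate (N + 1) v).flatten ++ w) ∈ L

theorem IsAperiodic.of_finite {L : Language α} (hL : {w : List α | w ∈ L}.Finite) :
    L.IsAperiodic := by
  obtain ⟨b, hb⟩ := (hL.image List.length).bddAbove
  have hlen : ∀ w ∈ L, w.length ≤ b := fun w hw => hb ⟨w, hw, rfl⟩
  refine ⟨b + 1, fun N hN u v w => ?_⟩
  -- Powers of the empty word are all equal; a power of a nonempty word beyond `b` is too long to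
  -- lie in `L`.
  rcases v.eq_nil_or_concat with rfl | ⟨v', a, rfl⟩
  · simp
  · refine iff_of_false (fun h => ?_) (fun h => ?_) <;>
    · have := hlen _ h
      simp only [List.length_append, List.length_flatten, List.map_replicate,
        List.sum_replicate, List.length_concat, smul_eq_mul] at this
      nlinarith

theorem IsAperiodic.compl {L : Language α} (hL : L.IsAperiodic) : Lᶜ.IsAperiodic := by
  obtain ⟨n, hn⟩ := hL
  exact ⟨n, fun N hN u v w => not_congr (hn N hN u v w)⟩

theorem IsAperiodic.sup {K L : Language α} (hK : K.IsAperiodic) (hL : L.IsAperiodic) :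
    (K ⊔ L).IsAperiodic := by
  obtain ⟨n, hn⟩ := hK
  obtain ⟨k, hk⟩ := hL
  exact ⟨max n k, fun N hN u v w => or_congr (hn N (le_of_max_le_left hN) u v w)
    (hk N (le_of_max_le_right hN) u v w)⟩

theorem IsAperiodic.inf {K L : Language α} (hK : K.IsAperiodic) (hL : L.IsAperiodic) :
    (K ⊓ L).IsAperiodic := by
  obtain ⟨n, hn⟩ := hK
  obtain ⟨k, hk⟩ := hL
  exact ⟨max n k, fun N hN u v w => and_congr (hn N (le_of_max_le_left hN) u v w)
    (hk N (le_of_max_le_right hN) u v w)⟩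

/-- The cut between the two factors falls either within `u ++ v ^ p`, so that the block `v ^ q` can
be pumped inside the factor in `L`, or after it, so that `v ^ p` can be pumped inside the factor in
`K`. By `hpq` both cases produce the same word. -/
theorem append_flatten_replicate_mem_mul {K L : Language α} {p q p' q' : ℕ} {u v w : List α}
    (hK : ∀ z, u ++ ((List.replicate p v).flatten ++ z) ∈ K →
      u ++ ((List.replicate p' v).flatten ++ z) ∈ K)
    (hL : ∀ z, z ++ ((List.replicate q v).flatten ++ w) ∈ L →
      z ++ ((List.replicate q' v).flatten ++ w) ∈ L)
    (hpq : p' + q = p + q')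
    (h : u ++ ((List.replicate (p + q) v).flatten ++ w) ∈ K * L) :
    u ++ ((List.replicate (p + q') v).flatten ++ w) ∈ K * L := by
  obtain ⟨x, hx, y, hy, hxy⟩ := mem_mul.1 h
  rw [List.replicate_add, List.flatten_append, List.append_assoc, ← List.append_assoc u,
    List.append_eq_append_iff] at hxy
  rcases hxy with ⟨t, ht, rfl⟩ | ⟨z, rfl, hz⟩
  · refine mem_mul.2 ⟨x, hx, _, hL t hy, ?_⟩
    rw [List.replicate_add, List.flatten_append, ← List.append_assoc x, ← ht]
    simp only [List.append_assoc]
  · rw [List.append_assoc] at hx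
    refine mem_mul.2 ⟨_, hK z hx, y, hy, ?_⟩
    rw [← hpq, List.replicate_add, List.flatten_append]
    simp only [List.append_assoc, hz]

theorem IsAperiodic.mul {K L : Language α} (hK : K.IsAperiodic) (hL : L.IsAperiodic) :
    (K * L).IsAperiodic := by
  obtain ⟨n, hn⟩ := hK
  obtain ⟨k, hk⟩ := hL
  -- The extra 1 serves the converse, where `n + 1` copies are set aside for `K` and at least `k`
  -- must remain for `L`.
  refine ⟨n + k + 1, fun N hN u v w => ⟨fun h => ?_, fun h => ?_⟩⟩
  · obtain ⟨q, rfl⟩ : ∃ q, N = n + q := ⟨N - n, by omega⟩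
    exact append_flatten_replicate_mem_mul (p' := n + 1) (q' := q + 1)
      (fun z => (hn n le_rfl u v z).1) (fun z => (hk q (by omega) z v w).1) (by omega) h
  · obtain ⟨q, rfl⟩ : ∃ q, N = n + 1 + q := ⟨N - n - 1, by omega⟩
    exact append_flatten_replicate_mem_mul (p := n + 1) (q := q + 1) (p' := n)
      (fun z => (hn n le_rfl u v z).2) (fun z => (hk q (by omega) z v w).2) (by omega) h

theorem IsStarFree.isAperiodic {L : Language α} (hL : L.IsStarFree) : L.IsAperiodic := by
  induction hL with
  | of_finite h => exact .of_finite h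
  | sup _ _ hK hL => exact hK.sup hL
  | inf _ _ hK hL => exact hK.inf hL
  | compl _ h => exact h.compl
  | mul _ _ hK hL => exact hK.mul hL

/-- Even powers of `w` after `u` lead to `A` and odd ones to `B`; for large exponents aperiodicity
identifies the two. -/
theorem IsAperiodic.not_swap {L A B : Language α} (hL : L.IsAperiodic) {u w : List α}
    (hA : L.leftQuotient u = A) (hAB : A.leftQuotient w = B) (hBA : B.leftQuotient w = A) :
    A = B := by
  have key : ∀ k, (L.leftQuotient (u ++ (List.replicate (2 * k) w).flatten) = A) := by
    intro k
    induction k with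
    | zero => simpa using hA
    | succ k ih =>
      have : 2 * (k + 1) = 2 * k + 1 + 1 := by ring
      rw [this, List.replicate_succ', List.replicate_succ', List.flatten_append,
        List.flatten_append, ← List.append_assoc, ← List.append_assoc, leftQuotient_append,
        leftQuotient_append, ih]
      simp [hAB, hBA]
  obtain ⟨n, hn⟩ := hL
  have hmem : ∀ y, u ++ (List.replicate (2 * n) w).flatten ++ y ∈ L ↔ y ∈ A := fun y => by
    rw [← key n, mem_leftQuotient]
  ext z
  have h := hn (2 * n) (by omega) u w z
  rw [List.replicate_succ', List.flatten_append] at h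
  simp only [← List.append_assoc] at h
  rw [hmem, List.append_assoc _ _ z, hmem] at h
  rw [h, ← hAB]
  simp

/-! ### Left quotients of products -/

theorem cons_mem_mul {K L : Language α} {a : α} {w : List α} :
    a :: w ∈ K * L ↔ w ∈ K.leftQuotient [a] * L ∨ [] ∈ K ∧ a :: w ∈ L := by
  simp only [mem_mul]
  constructor
  · rintro ⟨x, hx, y, hy, hxy⟩
    rcases x with _ | ⟨b, x⟩
    · exact .inr ⟨hx, by simpa [← hxy] using hy⟩
    · obtain ⟨rfl, rfl⟩ : b = a ∧ x ++ y = w := by simpa using hxy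
      exact .inl ⟨x, hx, y, hy, rfl⟩
  · rintro (⟨x, hx, y, hy, rfl⟩ | ⟨hK, hL⟩)
    · exact ⟨a :: x, hx, y, hy, rfl⟩
    · exact ⟨[], hK, _, hL, rfl⟩

theorem leftQuotient_singleton_mul_of_mem {K : Language α} (L : Language α) (a : α) (h : [] ∈ K) :
    (K * L).leftQuotient [a] = K.leftQuotient [a] * L + L.leftQuotient [a] := by
  ext w
  simp [cons_mem_mul, h, mem_add]

theorem leftQuotient_singleton_mul_of_notMem {K : Language α} (L : Language α) (a : α)
    (h : [] ∉ K) : (K * L).leftQuotient [a] = K.leftQuotient [a] * L := by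
  ext w
  simp [cons_mem_mul, h]

theorem leftQuotient_add (K L : Language α) (x : List α) :
    (K + L).leftQuotient x = K.leftQuotient x + L.leftQuotient x := rfl

theorem le_mul_of_nil_mem {K : Language α} (L : Language α) (h : [] ∈ K) : L ≤ K * L :=
  fun w hw => mem_mul.2 ⟨[], h, w, hw, rfl⟩

/-- If one of two quotients of an aperiodic language exhausting all of them lacks the empty word
and the other one has it, then the former is contained in the latter. -/
theorem IsAperiodic.quotient_le {L A B : Language α} (hL : L.IsAperiodic)
    (hr : Set.range L.leftQuotient = {A, B}) (hA : [] ∉ A) (hB : [] ∈ B) : A ≤ B := by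
  intro w (hw : w ∈ A)
  by_contra (hwB : w ∉ B)
  have hAr : A ∈ Set.range L.leftQuotient := by simp [hr]
  have hBr : B ∈ Set.range L.leftQuotient := by simp [hr]
  obtain ⟨u, hu⟩ := hAr
  obtain ⟨u', hu'⟩ := hBr
  have h1 : A.leftQuotient w ∈ Set.range L.leftQuotient :=
    ⟨u ++ w, by rw [leftQuotient_append, hu]⟩
  have h2 : B.leftQuotient w ∈ Set.range L.leftQuotient :=
    ⟨u' ++ w, by rw [leftQuotient_append, hu']⟩
  rw [hr] at h1 h2
  have h3 : [] ∈ A.leftQuotient w := by simpa using hw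
  have h4 : [] ∉ B.leftQuotient w := by simpa using hwB
  -- Among `A` and `B`, the empty word tells which quotient is reached, so `w` swaps them.
  have h5 : A.leftQuotient w = B := h1.resolve_left fun h => hA (h ▸ h3)
  have h6 : B.leftQuotient w = A := h2.resolve_right fun h => h4 (by rw [h]; exact hB)
  have h7 : A = B := hL.not_swap hu h5 h6
  exact hA (by rwa [h7])

/-- If both quotients agreed on the empty word, membership in `L` would be the same for all words,
and `L` would have a single quotient. -/
theorem exists_range_leftQuotient_eq_pair {L : Language α} (h : L.quotientComplexity = 2) :
    ∃ L', Set.range L.leftQuotient = {L, L'} ∧ ([] ∈ L' ↔ [] ∉ L) := by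
  obtain ⟨A, B, hne, hr⟩ := Set.encard_eq_two.1 h
  obtain ⟨L', hne, hr⟩ : ∃ L', L ≠ L' ∧ Set.range L.leftQuotient = {L, L'} := by
    have : L ∈ Set.range L.leftQuotient := ⟨[], rfl⟩
    rw [hr] at this
    rcases this with h | h
    · exact ⟨B, h ▸ hne, h ▸ hr⟩
    · exact ⟨A, h ▸ hne.symm, by rw [hr, Set.pair_comm]; exact h ▸ rfl⟩
  refine ⟨L', hr, ?_⟩
  have hq : ∀ w, L.leftQuotient w = L ∨ L.leftQuotient w = L' := fun w => by
    have : L.leftQuotient w ∈ Set.range L.leftQuotient := ⟨w, rfl⟩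
    rwa [hr] at this
  obtain ⟨u, hu⟩ : L' ∈ Set.range L.leftQuotient := by simp [hr]
  by_contra hcon
  have hiff : [] ∈ L' ↔ [] ∈ L := by tauto
  have hall : ∀ w, w ∈ L ↔ [] ∈ L := fun w => by
    have : w ∈ L ↔ [] ∈ L.leftQuotient w := by simp
    rw [this]
    rcases hq w with h | h <;> rw [h]
    exact hiff
  refine hne (ext fun w => ?_)
  rw [← hu, mem_leftQuotient, hall w, hall (u ++ w)]

/-! ### The upper bounds -/

theorem quotientComplexity_mul_le_of_nil_notMem {K L : Language α} (hL : L.IsAperiodic)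
    (h2 : L.quotientComplexity = 2) (hnil : [] ∉ L) :
    (K * L).quotientComplexity ≤ K.quotientComplexity + 2 := by
  obtain ⟨L', hr, hL'⟩ := exists_range_leftQuotient_eq_pair h2
  have hle : L ≤ L' := hL.quotient_le hr hnil (hL'.2 hnil)
  have hq : ∀ w, L.leftQuotient w = L ∨ L.leftQuotient w = L' := fun w => by
    have : L.leftQuotient w ∈ Set.range L.leftQuotient := ⟨w, rfl⟩
    rwa [hr] at this
  have hq' : ∀ w, L'.leftQuotient w = L ∨ L'.leftQuotient w = L' := fun w => by
    obtain ⟨u, hu⟩ : L' ∈ Set.range L.leftQuotient := by simp [hr]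
    rw [← hu, ← leftQuotient_append, hu]
    exact hq _
  -- Both quotients of `L` contain `L`, so prefixing any word to a word of `L` stays in `L`.
  have hideal : ∀ A : Language α, A * L ≤ L := by
    intro A w (hw : w ∈ A * L)
    change w ∈ L
    obtain ⟨x, -, y, hy, rfl⟩ := mem_mul.1 hw
    rw [← mem_leftQuotient]
    rcases hq x with h | h <;> rw [h]
    exacts [hy, hle hy]
  have hsub : Set.range (K * L).leftQuotient ⊆
      (· * L) '' Set.range K.leftQuotient ∪ {L, L'} := by
    rintro _ ⟨x, rfl⟩
    have key : (K * L).leftQuotient x = K.leftQuotient x * L ∨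
        (K * L).leftQuotient x = L ∨ (K * L).leftQuotient x = L' := by
      induction x using List.reverseRecOn with
      | nil => exact .inl rfl
      | append_singleton x a ih =>
        rw [leftQuotient_append, leftQuotient_append]
        rcases ih with h | h | h <;> rw [h]
        -- Once the quotient of `K` contains `[]`, its product with `L` is `L` itself, and `K` plays
        -- no further role.
        · by_cases hn : [] ∈ K.leftQuotient x
          · have : K.leftQuotient x * L = L :=
              le_antisymm (hideal _) (le_mul_of_nil_mem L hn)
            rw [this]
            exact .inr (hq _)
          · exact .inl (leftQuotient_singleton_mul_of_notMem L a hn)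
        · exact .inr (hq _)
        · exact .inr (hq' _)
    rcases key with h | h
    · exact .inl ⟨_, ⟨x, rfl⟩, h.symm⟩
    · exact .inr h
  calc (K * L).quotientComplexity
      ≤ ((· * L) '' Set.range K.leftQuotient ∪ {L, L'}).encard := Set.encard_mono hsub
    _ ≤ ((· * L) '' Set.range K.leftQuotient).encard + ({L, L'} : Set (Language α)).encard :=
        Set.encard_union_le _ _
    _ ≤ K.quotientComplexity + 2 := by
        gcongr
        · exact Set.encard_image_le _ _
        · rw [← hr]
          exact h2.le

theorem quotientComplexity_mul_le_of_nil_mem {K L : Language α} (hL : L.IsAperiodic)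
    (h2 : L.quotientComplexity = 2) (hnil : [] ∈ L) {m : ℕ} (hm : 2 ≤ m)
    (hK : K.quotientComplexity = m) :
    (K * L).quotientComplexity ≤ ((3 * m - 2 : ℕ) : ℕ∞) := by
  obtain ⟨L', hr, hL'⟩ := exists_range_leftQuotient_eq_pair h2
  have hle : L' ≤ L := hL.quotient_le (by rw [hr, Set.pair_comm]) (by tauto) hnil
  have hq : ∀ w, L.leftQuotient w = L ∨ L.leftQuotient w = L' := fun w => by
    have : L.leftQuotient w ∈ Set.range L.leftQuotient := ⟨w, rfl⟩
    rwa [hr] at this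
  have hq' : ∀ w, L'.leftQuotient w = L ∨ L'.leftQuotient w = L' := fun w => by
    obtain ⟨u, hu⟩ : L' ∈ Set.range L.leftQuotient := by simp [hr]
    rw [← hu, ← leftQuotient_append, hu]
    exact hq _
  have hadd : L + L' = L := sup_eq_left.2 hle
  have hadd' : L' + L = L := sup_eq_right.2 hle
  -- The empty language has only one quotient, so `2 ≤ m` makes `K` nonempty and gives it a quotient
  -- containing `[]`.
  obtain ⟨z, hz⟩ : ∃ z, z ∈ K := by
    by_contra! hcon
    have hsub : Set.range K.leftQuotient ⊆ {K} := by
      rintro _ ⟨x, rfl⟩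
      exact ext fun w => iff_of_false (hcon _) (hcon _)
    have h1 : (m : ℕ∞) ≤ 1 := by
      rw [← hK, ← Set.encard_singleton K]
      exact Set.encard_mono hsub
    have : m ≤ 1 := by exact_mod_cast h1
    omega
  have hA₀ : [] ∈ K.leftQuotient z := by simpa using hz
  set A₀ := K.leftQuotient z with hA₀def
  have key : ∀ x, ∃ T ∈ ({0, L, L'} : Set (Language α)),
      (K * L).leftQuotient x = K.leftQuotient x * L + T := by
    intro x
    induction x using List.reverseRecOn with
    | nil => exact ⟨0, by simp, by simp⟩
    | append_singleton x a ih =>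
      obtain ⟨T, hT, h⟩ := ih
      have hTa : T.leftQuotient [a] ∈ ({0, L, L'} : Set (Language α)) := by
        rcases hT with rfl | rfl | rfl
        · exact .inl rfl
        · exact .inr (hq _)
        · exact .inr (hq' _)
      rw [leftQuotient_append, leftQuotient_append, h, leftQuotient_add]
      by_cases hn : [] ∈ K.leftQuotient x
      · rw [leftQuotient_singleton_mul_of_mem L a hn, add_assoc]
        refine ⟨_, ?_, rfl⟩
        rcases hq [a] with h1 | h1 <;> 
            rcases hTa with h2 | h2 | (h2 : _ = L') <;> simp [h1, h2, hadd, hadd']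
      · rw [leftQuotient_singleton_mul_of_notMem L a hn]
        exact ⟨_, hTa, rfl⟩
  -- Only `A₀` is singled out: its product with `L` contains `L`, hence absorbs all three choices of
  -- `T`. Each other quotient of `K` contributes at most three.
  have hsub : Set.range (K * L).leftQuotient ⊆
      (fun p : Language α × Language α => p.1 * L + p.2) ''
        ((Set.range K.leftQuotient \ {A₀}) ×ˢ {0, L, L'}) ∪ {A₀ * L} := by
    rintro _ ⟨x, rfl⟩
    obtain ⟨T, hT, h⟩ := key x
    by_cases hx : K.leftQuotient x = A₀
    · refine .inr ?_
      rw [hx] at h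
      have hTL : T ≤ L := by
        rcases hT with rfl | rfl | rfl
        exacts [bot_le, le_rfl, hle]
      rw [h]
      exact sup_eq_left.2 (hTL.trans (le_mul_of_nil_mem L hA₀))
    · exact .inl ⟨(_, T), ⟨⟨⟨x, rfl⟩, hx⟩, hT⟩, h.symm⟩
  have hcard : (Set.range K.leftQuotient \ {A₀}).encard = ((m - 1 : ℕ) : ℕ∞) := by
    have hmem : A₀ ∈ Set.range K.leftQuotient := ⟨z, rfl⟩
    rw [Set.encard_sdiff_singleton_of_mem hmem, ENat.natCast_sub]
    exact congrArg (· - 1) hK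
  have h3 : ({0, L, L'} : Set (Language α)).encard ≤ 3 := by
    refine (Set.encard_insert_le _ _).trans ?_
    rw [← hr]
    refine (add_le_add_left h2.le 1).trans ?_
    norm_num
  calc (K * L).quotientComplexity
      ≤ _ := Set.encard_mono hsub
    _ ≤ _ := Set.encard_union_le _ _
    _ ≤ ((m - 1 : ℕ) : ℕ∞) * 3 + 1 := by
        gcongr
        · refine (Set.encard_image_le _ _).trans ?_
          rw [Set.encard_prod, hcard]
          gcongr
        · simp
    _ = ((3 * m - 2 : ℕ) : ℕ∞) := by
        have : 3 * m - 2 = (m - 1) * 3 + 1 := by omega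
        rw [this]
        push_cast
        rfl

/-! ### Languages attaining the bound -/

theorem encard_le_quotientComplexity {α σ : Type*} (M : DFA α σ) {S : Set σ}
    (hS : S ⊆ Set.range M.eval) (hinj : Set.InjOn M.acceptsFrom S) :
    S.encard ≤ M.accepts.quotientComplexity := by
  rw [← hinj.encard_image, quotientComplexity, leftQuotient_accepts, Set.range_comp]
  exact Set.encard_mono (Set.image_mono hS)

theorem isStarFree_top {α : Type*} : (⊤ : Language α).IsStarFree := by
  rw [← compl_bot]
  exact .compl (.of_finite Set.finite_empty)

/-- The words consisting of a single letter that satisfies `p`. -/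
def singletons {α : Type*} (p : α → Prop) : Language α := {w | ∃ x, p x ∧ w = [x]}

theorem isStarFree_singletons {α : Type*} [Finite α] (p : α → Prop) :
    (singletons p).IsStarFree := by
  refine .of_finite ((Set.finite_range fun x : α => [x]).subset ?_)
  rintro _ ⟨x, -, rfl⟩
  exact ⟨x, rfl⟩

/-- The counter of the automata below: the first component of a letter leaves the counter unchanged,
increments it or resets it. -/
def counterStep (q : ℕ) (x : Option Bool × Bool) : ℕ :=
  match x.1 with
  | none => q
  | some true => q + 1
  | some false => 0

/-- The automaton accepting when the counter is at least `n`. -/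
def counterDFA (n : ℕ) : DFA (Option Bool × Bool) ℕ where
  step := counterStep
  start := 0
  accept := {q | n ≤ q}

/-- The automaton remembering the second component of the last letter. -/
def flagDFA : DFA (Option Bool × Bool) Bool where
  step _ x := x.2
  start := true
  accept := {true}

/-- The automaton for the product of the languages of `counterDFA n` and `flagDFA`. -/
def counterFlagDFA (n : ℕ) : DFA (Option Bool × Bool) (ℕ × Option Bool) where
  step s x := (counterStep s.1 x, if n ≤ s.1 ∨ s.2 ≠ none then some x.2 else none)
  start := (0, none)
  accept := {s | n ≤ s.1 ∨ s.2 = some true}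

theorem isStarFree_accepts_flagDFA : flagDFA.accepts.IsStarFree := by
  have h : flagDFA.accepts =
      ({[]} : Language (Option Bool × Bool)) ⊔ ⊤ * singletons fun x => x.2 = true := by
    ext w
    change _ ↔ w = [] ∨ w ∈ (⊤ * singletons fun x => x.2 = true : Language (Option Bool × Bool))
    rw [mem_mul, DFA.mem_accepts]
    induction w using List.reverseRecOn with
    | nil => exact iff_of_true rfl (.inl rfl)
    | append_singleton w x =>
      rw [DFA.eval_append_singleton]
      constructor
      · intro hx
        exact .inr ⟨w, trivial, [x], ⟨x, hx, rfl⟩, rfl⟩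
      · rintro (h | ⟨u, -, _, ⟨y, hy, rfl⟩, h⟩)
        · simp at h
        · obtain ⟨rfl, rfl⟩ : u = w ∧ y = x := by simpa using h
          exact hy
  rw [h]
  exact .sup (.of_finite (Set.finite_singleton _)) (.mul isStarFree_top (isStarFree_singletons _))

theorem le_foldl_counterStep {v : List (Option Bool × Bool)} (hv : ∀ x ∈ v, x.1 ≠ some false)
    (q : ℕ) : q ≤ v.foldl counterStep q := by
  induction v generalizing q with
  | nil => rfl
  | cons x v ih =>
    refine le_trans ?_ (ih (fun y hy => hv y (.tail _ hy)) _)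
    have := hv x (.head _)
    unfold counterStep
    rcases x with ⟨_ | _ | _, _⟩ <;> simp_all

/-- The words without letters that reset the counter. -/
def noReset : Language (Option Bool × Bool) := {v | ∀ x ∈ v, x.1 ≠ some false}

theorem isStarFree_noReset : noReset.IsStarFree := by
  have h : noReset = (⊤ * singletons (fun x => x.1 = some false) * ⊤)ᶜ := by
    ext v
    change (∀ x ∈ v, x.1 ≠ some false) ↔ ¬ (v ∈ _ * _ * _)
    constructor
    · intro h hv
      obtain ⟨_, hu, z, -, rfl⟩ := mem_mul.1 hv
      obtain ⟨u, -, _, ⟨x, hx, rfl⟩, rfl⟩ := mem_mul.1 hu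
      exact h x (by simp) hx
    · intro h x hx hx1
      obtain ⟨u, z, rfl⟩ := List.append_of_mem hx
      refine h (mem_mul.2 ⟨u ++ [x], mem_mul.2 ⟨u, trivial, [x], ⟨x, hx1, rfl⟩, rfl⟩,
        z, trivial, ?_⟩)
      simp
  rw [h]
  exact .compl (.mul (.mul isStarFree_top (isStarFree_singletons _)) isStarFree_top)

/-- The counter ends at `n + 1` or more exactly when some increment follows a prefix that brings the
counter to at least `n` and is itself followed by no reset. -/
theorem isStarFree_accepts_counterDFA (n : ℕ) : (counterDFA n).accepts.IsStarFree := by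
  induction n with
  | zero =>
    have h : (counterDFA 0).accepts = ⊤ := ext fun w => iff_of_true (Nat.zero_le _) trivial
    rw [h]
    exact isStarFree_top
  | succ n ih =>
    have h : (counterDFA (n + 1)).accepts = (counterDFA n).accepts *
        singletons (fun x => x.1 = some true) * noReset := by
      ext w
      constructor
      · induction w using List.reverseRecOn with
        | nil => exact fun h => absurd h (Nat.not_succ_le_zero n)
        | append_singleton w x ihw =>
          intro h
          rw [DFA.mem_accepts, DFA.eval_append_singleton] at h
          rcases x with ⟨_ | _ | _, b⟩
          · obtain ⟨u, hu, v, hv, rfl⟩ := mem_mul.1 (ihw h)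
            refine mem_mul.2 ⟨u, hu, v ++ [(none, b)], ?_, by simp⟩
            intro x hx
            rcases List.mem_append.1 hx with hx | hx
            · exact hv x hx
            · simp_all
          · exact absurd h (Nat.not_succ_le_zero n)
          · refine mem_mul.2 ⟨w ++ [(some true, b)], mem_mul.2 ⟨w, ?_, _, ⟨_, rfl, rfl⟩, rfl⟩,
              [], ?_, by simp⟩
            · exact Nat.le_of_succ_le_succ h
            · exact fun x hx => absurd hx (by simp)
      · intro hw
        obtain ⟨_, hux, v, hv, rfl⟩ := mem_mul.1 hw
        obtain ⟨u, hu, _, ⟨x, hx, rfl⟩, rfl⟩ := mem_mul.1 hux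
        change n + 1 ≤ List.foldl counterStep 0 (u ++ [x] ++ v)
        rw [List.foldl_append, List.foldl_append]
        refine le_trans ?_ (le_foldl_counterStep hv _)
        have hu' : n ≤ List.foldl counterStep 0 u := hu
        simpa [counterStep, hx] using hu'
    rw [h]
    exact .mul (.mul ih (isStarFree_singletons _)) isStarFree_noReset

theorem foldl_counterStep_replicate (q k : ℕ) (b : Bool) :
    (List.replicate k (some true, b)).foldl counterStep q = q + k := by
  induction k generalizing q with
  | zero => rfl
  | succ k ih =>
    rw [List.replicate_succ, List.foldl_cons, ih]
    simp only [counterStep]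
    omega

theorem acceptsFrom_counterDFA_of_le {n q : ℕ} (h : n ≤ q) :
    (counterDFA n).acceptsFrom q = (counterDFA n).acceptsFrom n := by
  have key : ∀ (w : List (Option Bool × Bool)) (p q : ℕ), n ≤ p → n ≤ q →
      (n ≤ w.foldl counterStep p ↔ n ≤ w.foldl counterStep q) := by
    intro w
    induction w with
    | nil => exact fun p q hp hq => iff_of_true hp hq
    | cons x w ih =>
      intro p q hp hq
      rcases x with ⟨_ | _ | _, b⟩
      exacts [ih _ _ hp hq, Iff.rfl, ih _ _ (hp.trans (Nat.le_succ p)) (hq.trans (Nat.le_succ q))]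
  exact ext fun w => key w q n h le_rfl

theorem quotientComplexity_accepts_counterDFA (n : ℕ) :
    (counterDFA n).accepts.quotientComplexity = ((n + 1 : ℕ) : ℕ∞) := by
  have hcard : (Set.Iic n).encard = ((n + 1 : ℕ) : ℕ∞) := by
    rw [← Finset.coe_Iic, Set.encard_coe_eq_coe_finsetCard, Nat.card_Iic]
  refine le_antisymm ?_ ?_
  · rw [← hcard]
    refine le_trans (Set.encard_mono ?_) (Set.encard_image_le (counterDFA n).acceptsFrom _)
    rintro _ ⟨x, rfl⟩
    rw [leftQuotient_accepts_apply]
    rcases le_total n ((counterDFA n).eval x) with h | h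
    · exact ⟨n, Set.self_mem_Iic, (acceptsFrom_counterDFA_of_le h).symm⟩
    · exact ⟨_, h, rfl⟩
  · rw [← hcard]
    refine encard_le_quotientComplexity _ ?_ ?_
    · intro k _
      exact ⟨List.replicate k (some true, true),
        (foldl_counterStep_replicate 0 k true).trans (Nat.zero_add k)⟩
    · intro p hp q hq h
      -- Appending `k` increments tests whether the counter is at least `n - k`; `k = n - p` and `k
      -- = n - q` determine a value up to `n`.
      have key : ∀ k, n ≤ p + k ↔ n ≤ q + k := fun k => by
        have := Set.ext_iff.1 h (List.replicate k (some true, true))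
        rw [← foldl_counterStep_replicate p k true, ← foldl_counterStep_replicate q k true]
        exact this
      have h1 := key (n - p)
      have h2 := key (n - q)
      have hp' : p ≤ n := hp
      have hq' : q ≤ n := hq
      omega

theorem quotientComplexity_accepts_flagDFA : flagDFA.accepts.quotientComplexity = 2 := by
  have hr : Set.range flagDFA.accepts.leftQuotient = flagDFA.acceptsFrom '' {true, false} := by
    rw [leftQuotient_accepts, Set.range_comp]
    congr 1
    refine Set.eq_of_subset_of_subset (fun b _ => by cases b <;> simp) ?_
    rintro _ (rfl | rfl)
    exacts [⟨[], rfl⟩, ⟨[(none, false)], rfl⟩]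
  rw [quotientComplexity, hr, Set.image_pair, Set.encard_pair]
  intro h
  have : false = true := (Set.ext_iff.1 h []).1 rfl
  simp at this

/-- The state of `flagDFA` after a letter depends on that letter alone, so all runs of it that have
read a letter agree. One optional flag therefore replaces a set of states, `none` meaning that no
run has yet read a letter. -/
theorem mem_acceptsFrom_counterFlagDFA {n : ℕ} {w : List (Option Bool × Bool)} {q : ℕ}
    {s : Option Bool} :
    w ∈ (counterFlagDFA n).acceptsFrom (q, s) ↔
      w ∈ (counterDFA n).acceptsFrom q * flagDFA.accepts ∨ ∃ t ∈ s, w ∈ flagDFA.acceptsFrom t := by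
  induction w generalizing q s with
  | nil =>
    have h1 : [] ∈ (counterDFA n).acceptsFrom q * flagDFA.accepts ↔ n ≤ q := by
      simp only [mem_mul, List.append_eq_nil_iff]
      constructor
      · rintro ⟨_, h, _, -, rfl, rfl⟩
        exact h
      · exact fun h => ⟨[], h, [], rfl, rfl, rfl⟩
    rw [h1]
    refine or_congr Iff.rfl ?_
    constructor
    · rintro rfl
      exact ⟨true, rfl, rfl⟩
    · rintro ⟨t, ht, h⟩
      have : t = true := h
      exact this ▸ ht
  | cons x w ih =>
    have h1 : x :: w ∈ (counterFlagDFA n).acceptsFrom (q, s) ↔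
        w ∈ (counterFlagDFA n).acceptsFrom ((counterFlagDFA n).step (q, s) x) := Iff.rfl
    have h2 : ((counterDFA n).acceptsFrom q).leftQuotient [x] =
        (counterDFA n).acceptsFrom (counterStep q x) := rfl
    have h3 : ∀ t, x :: w ∈ flagDFA.acceptsFrom t ↔ w ∈ flagDFA.acceptsFrom x.2 :=
      fun t => Iff.rfl
    have h4 : x :: w ∈ flagDFA.accepts ↔ w ∈ flagDFA.acceptsFrom x.2 := Iff.rfl
    have h5 : [] ∈ (counterDFA n).acceptsFrom q ↔ n ≤ q := Iff.rfl
    rw [h1, cons_mem_mul, h2, h4, h5]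
    simp only [h3, counterFlagDFA, or_assoc]
    rw [← counterFlagDFA, ih]
    refine or_congr Iff.rfl ?_
    rcases s with _ | s <;> by_cases hq : n ≤ q <;> simp [hq]

theorem accepts_counterFlagDFA (n : ℕ) :
    (counterFlagDFA n).accepts = (counterDFA n).accepts * flagDFA.accepts := by
  ext w
  refine mem_acceptsFrom_counterFlagDFA.trans ?_
  simp only [Option.mem_def, reduceCtorEq, false_and, exists_false, or_false]
  rfl

theorem evalFrom_counterFlagDFA_fst (n : ℕ) (w : List (Option Bool × Bool))
    (s : ℕ × Option Bool) :
    ((counterFlagDFA n).evalFrom s w).1 = w.foldl counterStep s.1 := by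
  induction w generalizing s with
  | nil => rfl
  | cons x w ih => exact ih _

/-- The last letter leaves the counter alone and turns off any flag, so acceptance depends on the
counter only. -/
theorem append_singleton_mem_acceptsFrom_counterFlagDFA {n p k : ℕ} {s : Option Bool} :
    List.replicate k (some true, false) ++ [(none, false)] ∈ (counterFlagDFA n).acceptsFrom (p, s) ↔
      n ≤ p + k := by
  rw [DFA.mem_acceptsFrom, DFA.evalFrom_append_singleton]
  have h := evalFrom_counterFlagDFA_fst n (List.replicate k (some true, false)) (p, s)
  rw [foldl_counterStep_replicate] at h
  generalize (counterFlagDFA n).evalFrom (p, s) (List.replicate k (some true, false)) = t at h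
  simp only at h
  rw [← h]
  refine or_iff_left ?_
  simp only [counterFlagDFA]
  split_ifs <;> simp

theorem le_quotientComplexity_accepts_counterFlagDFA {n : ℕ} :
    ((3 * n + 1 : ℕ) : ℕ∞) ≤ (counterFlagDFA n).accepts.quotientComplexity := by
  -- All three flags are kept for counters below `n`, but only one state at `n`, where every flag
  -- accepts the same words.
  have hcard : (insert (n, none) (Set.Iio n ×ˢ Set.univ) : Set (ℕ × Option Bool)).encard =
      ((3 * n + 1 : ℕ) : ℕ∞) := by
    rw [Set.encard_insert_of_notMem (by simp), Set.encard_prod, ← Finset.coe_Iio,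
      Set.encard_coe_eq_coe_finsetCard, Nat.card_Iio, Set.encard_univ, ENat.card_eq_coe_fintype_card]
    simp [mul_comm]
  rw [← hcard]
  have hnone : ∀ k ≤ n, (counterFlagDFA n).eval (List.replicate k (some true, false)) =
      (k, none) := by
    intro k
    induction k with
    | zero => exact fun _ => rfl
    | succ k ih =>
      intro hk
      rw [List.replicate_succ', DFA.eval_append_singleton, ih (by omega)]
      simp [counterFlagDFA, counterStep, show ¬ n ≤ k by omega]
  -- Reaching `n` lets the next letter, a reset, start a flag, which is never lost afterwards; `k`
  -- increments then set the counter and a neutral letter sets the flag to `b`.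
  have hsome : ∀ (k : ℕ) (b : Bool), (counterFlagDFA n).eval (List.replicate n (some true, false) ++
      [(some false, false)] ++ List.replicate k (some true, false) ++ [(none, b)]) =
        (k, some b) := by
    intro k b
    have h : (counterFlagDFA n).eval (List.replicate n (some true, false) ++
        [(some false, false)] ++ List.replicate k (some true, false)) = (k, some false) := by
      induction k with
      | zero =>
        rw [List.replicate_zero, List.append_nil, DFA.eval_append_singleton, hnone n le_rfl]
        simp [counterFlagDFA, counterStep]
      | succ k ih =>
        rw [List.replicate_succ', ← List.append_assoc, DFA.eval_append_singleton, ih]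
        simp [counterFlagDFA, counterStep]
    rw [DFA.eval_append_singleton, h]
    simp [counterFlagDFA, counterStep]
  refine encard_le_quotientComplexity _ ?_ ?_
  · rintro ⟨k, s⟩ h
    rcases s with _ | b
    · refine ⟨_, hnone k ?_⟩
      rcases h with h | h
      · exact (congrArg Prod.fst h).le
      · exact le_of_lt h.1
    · exact ⟨_, hsome k b⟩
  · rintro ⟨p, s⟩ hp ⟨q, t⟩ hq h
    have hp' : p ≤ n := hp.elim (fun h => (congrArg Prod.fst h).le) fun h => le_of_lt h.1
    have hq' : q ≤ n := hq.elim (fun h => (congrArg Prod.fst h).le) fun h => le_of_lt h.1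
    have hmem : ∀ w, w ∈ (counterFlagDFA n).acceptsFrom (p, s) ↔
        w ∈ (counterFlagDFA n).acceptsFrom (q, t) := fun w => by rw [h]
    have key : ∀ k, n ≤ p + k ↔ n ≤ q + k := fun k => by
      rw [← append_singleton_mem_acceptsFrom_counterFlagDFA (s := s), hmem,
        append_singleton_mem_acceptsFrom_counterFlagDFA]
    have h1 := key (n - p)
    have h2 := key (n - q)
    obtain rfl : p = q := by omega
    rcases hp'.eq_or_lt with rfl | hlt
    · simp_all
    -- Below `n`, the empty word detects the flag `some true`, and a neutral letter carrying `true`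
    -- detects whether a flag is present.
    · have e1 : s = some true ↔ t = some true := by
        have : p < n ∧ _ := ⟨hlt, hmem []⟩
        simpa [DFA.mem_acceptsFrom, counterFlagDFA, hlt.not_ge] using this.2
      have e2 : s ≠ none ↔ t ≠ none := by
        have := hmem [(none, true)]
        simpa [DFA.mem_acceptsFrom, counterFlagDFA, counterStep, hlt.not_ge] using this
      rcases s with _ | _ | _ <;> rcases t with _ | _ | _ <;> simp_all

end Language

theorem mainTheorem2 (m : ℕ) (hm : 2 ≤ m) :
    (∀ (α : Type*) [Finite α] (K L : Language α),
        K.IsStarFree → L.IsStarFree →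
        K.quotientComplexity = (m : ℕ∞) → L.quotientComplexity = 2 →
          (K * L).quotientComplexity ≤ ((3 * m - 2 : ℕ) : ℕ∞) ∧
          ([] ∉ L → (K * L).quotientComplexity ≤ ((2 * m + 1 : ℕ) : ℕ∞))) ∧
    (∃ (α : Type) (_ : Finite α) (K L : Language α),
        K.IsStarFree ∧ L.IsStarFree ∧
        K.quotientComplexity = (m : ℕ∞) ∧ L.quotientComplexity = 2 ∧
          (K * L).quotientComplexity = ((3 * m - 2 : ℕ) : ℕ∞)) := by
  constructor
  · intro α _ K L _ hL hK h2
    have hap := hL.isAperiodic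
    have hnotMem : [] ∉ L → (K * L).quotientComplexity ≤ ((m + 2 : ℕ) : ℕ∞) := fun h => by
      simpa [hK] using Language.quotientComplexity_mul_le_of_nil_notMem (K := K) hap h2 h
    -- The bound `m + 2` lies below both `2 * m + 1` and `3 * m - 2` because `2 ≤ m`.
    refine ⟨?_, fun h => (hnotMem h).trans (by exact_mod_cast (by omega : m + 2 ≤ 2 * m + 1))⟩
    by_cases h : [] ∈ L
    · exact Language.quotientComplexity_mul_le_of_nil_mem hap h2 h hm hK
    · exact (hnotMem h).trans (by exact_mod_cast (by omega : m + 2 ≤ 3 * m - 2))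
  · obtain ⟨n, rfl⟩ : ∃ n, m = n + 1 := ⟨m - 1, by omega⟩
    have hK := Language.quotientComplexity_accepts_counterDFA n
    have h2 := Language.quotientComplexity_accepts_flagDFA
    have hL := Language.isStarFree_accepts_flagDFA
    refine ⟨Option Bool × Bool, inferInstance, (Language.counterDFA n).accepts,
      Language.flagDFA.accepts, Language.isStarFree_accepts_counterDFA n, hL, hK, h2, ?_⟩
    refine le_antisymm
      (Language.quotientComplexity_mul_le_of_nil_mem hL.isAperiodic h2 rfl hm hK) ?_
    rw [← Language.accepts_counterFlagDFA, show 3 * (n + 1) - 2 = 3 * n + 1 by omega]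
    exact Language.le_quotientComplexity_accepts_counterFlagDFA
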